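/- Let $k \ge 1$ be an integer. A finite simple graph is a \emph{$k$-tree} if it can be obtained from the complete graph on $k+1$ vertices by repeatedly adding a new vertex adjacent to all vertices of a $k$-clique of the current graph and to no other vertex. Let $G=(V,E)$ be a $k$-tree. The \emph{clique-intersection graph} of $G$ has the (inclusion-)maximal cliques of $G$ as vertices; two distinct maximal cliques $Q,Q'$ are joined by an edge when $Q\cap Q'\neq\emptyset$, and this edge has weight $|Q\cap Q'|$. A \emph{clique tree} of $G$ is a maximum-weight spanning tree of the clique-intersection graph. A set $S\subseteq V$ is a \emph{minimal vertex separator} if there are two distinct non-adjacent vertices $u,v\in V\setminus S$ such that $u$ and $v$ lie in distinct connected components of $G[V\setminus S]$, and no proper subset of $S$ separates $u$ from $v$ in this way; let $\mathbb S$ be the set of minimal vertex separators of $G$. Then $G$ has a clique tree; for every $S\subseteq V$ the number $\mu(S)$ of edges $\{Q,Q'\}$ of a clique tree $T$ with $Q\cap Q'=S$ is the same for every clique tree $T$ of $G$ (for $S \in \mathbb S$ it is the \emph{multiplicity} of $S$); and the number of clique trees of $G$ (counted as distinct trees on the set of maximal cliques) equals \[ \prod_{S\in\mathbb S}\bigl(\mu(S)+1\bigr)^{\mu(S)-1}.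 \] -/

import Mathlib

namespace KTreeClique

variable {V : Type*} [DecidableEq V]

/-- `IsKTreeOn k G s`: the subgraph of `G` induced by the finite vertex set `s` is a `k`-tree.
Base: a complete graph on `k + 1` vertices.  Step: a new vertex `v` is added whose neighbours in the
existing `k`-tree are exactly the vertices of one of its `k`-cliques `C`. -/
inductive IsKTreeOn (k : ℕ) (G : SimpleGraph V) : Finset V → Prop
  | base (s : Finset V) (hs : G.IsNClique (k + 1) s) : IsKTreeOn k G s
  | step (s C : Finset V) (v : V) (hs : IsKTreeOn k G s) (hv : v ∉ s) (hCs : C ⊆ s)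
      (hC : G.IsNClique k C) (hadj : ∀ w ∈ s, G.Adj v w ↔ w ∈ C) : IsKTreeOn k G (insert v s)

/-- The finite graph `G` is a `k`-tree. -/
def IsKTree [Fintype V] (k : ℕ) (G : SimpleGraph V) : Prop :=
  IsKTreeOn k G Finset.univ

/-- `S` is a `uv`-separator: `u` and `v` are distinct non-adjacent vertices outside `S` that lie in
distinct connected components of `G[V \ S]`. -/
def IsSeparatorFor {V : Type*} (G : SimpleGraph V) (u v : V) (S : Finset V) : Prop :=
  u ≠ v ∧ ¬ G.Adj u v ∧ ∃ (hu : u ∈ {x : V | x ∉ S}) (hv : v ∈ {x : V | x ∉ S}),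
    ¬ (G.induce {x : V | x ∉ S}).Reachable ⟨u, hu⟩ ⟨v, hv⟩

/-- `S` is a minimal vertex separator: for some pair `u, v` it is a `uv`-separator none of whose
proper subsets is a `uv`-separator. -/
def IsMinimalVertexSeparator {V : Type*} (G : SimpleGraph V) (S : Finset V) : Prop :=
  ∃ u v : V, IsSeparatorFor G u v S ∧ ∀ S' : Finset V, S' ⊂ S → ¬ IsSeparatorFor G u v S'

open scoped Classical in
/-- The set of minimal vertex separators of `G`. -/
noncomputable def minimalVertexSeparators {V : Type*} [Fintype V] (G : SimpleGraph V) :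
    Finset (Finset V) :=
  Finset.univ.filter fun S => IsMinimalVertexSeparator G S

/-- The type of (inclusion-)maximal cliques of `G`. -/
abbrev MaxClique {V : Type*} (G : SimpleGraph V) : Type _ :=
  {Q : Finset V // Maximal (fun s : Finset V => G.IsClique (s : Set V)) Q}

/-- The clique-intersection graph: distinct maximal cliques are adjacent when they meet. -/
def cliqueIntersectionGraph (G : SimpleGraph V) : SimpleGraph (MaxClique G) where
  Adj Q Q' := Q ≠ Q' ∧ (Q.1 ∩ Q'.1).Nonempty
  symm := ⟨fun Q Q' h => ⟨h.1.symm, by rw [Finset.inter_comm]; exact h.2⟩⟩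
  loopless := ⟨fun _ h => h.1 rfl⟩

/-- The intersection `Q ∩ Q'` of the two ends of the edge `{Q, Q'}`. -/
def edgeInter (G : SimpleGraph V) : Sym2 (MaxClique G) → Finset V :=
  Sym2.lift ⟨fun Q Q' => Q.1 ∩ Q'.1, fun Q Q' => Finset.inter_comm Q.1 Q'.1⟩

open scoped Classical in
/-- The multiset of the intersections `Q ∩ Q'` over all edges `{Q, Q'}` of `T`. -/
noncomputable def separatorMultiset [Fintype V] (G : SimpleGraph V)
    (T : SimpleGraph (MaxClique G)) : Multiset (Finset V) :=
  T.edgeFinset.val.map (edgeInter G)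

open scoped Classical in
/-- The total weight of `T`, where the edge `{Q, Q'}` has weight `|Q ∩ Q'|`. -/
noncomputable def totalWeight [Fintype V] (G : SimpleGraph V) (T : SimpleGraph (MaxClique G)) : ℕ :=
  ∑ e ∈ T.edgeFinset, (edgeInter G e).card

/-- `T` is a spanning tree of the clique-intersection graph of `G`. -/
def IsSpanningTree (G : SimpleGraph V) (T : SimpleGraph (MaxClique G)) : Prop :=
  T ≤ cliqueIntersectionGraph G ∧ T.IsTree

/-- A clique tree of `G` is a maximum-weight spanning tree of its clique-intersection graph. -/
def IsCliqueTree [Fintype V] (G : SimpleGraph V) (T : SimpleGraph (MaxClique G)) : Prop :=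
  IsSpanningTree G T ∧
    ∀ T' : SimpleGraph (MaxClique G), IsSpanningTree G T' → totalWeight G T' ≤ totalWeight G T

open scoped Classical in
/-- The multiplicity `μ(S)`: the number of edges `{Q, Q'}` of a clique tree with `Q ∩ Q' = S`
(computed in some clique tree, with value `0` if `G` has no clique tree). -/
noncomputable def multiplicity [Fintype V] (G : SimpleGraph V) (S : Finset V) : ℕ :=
  if h : ∃ T : SimpleGraph (MaxClique G), IsCliqueTree G T then
    (separatorMultiset G h.choose).count S
  else 0

end KTreeClique

/-! In a `k`-tree the maximal cliques are exactly the `(k + 1)`-cliques, so two of them share at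
most `k` vertices. They are connected through steps sharing exactly `k` vertices, so spanning trees
with every edge of weight `k` exist. Hence the clique trees are precisely the spanning trees of
`ridgeGraph` (`IsKTree.isCliqueTree_iff`).

For a `k`-set `S`, the maximal cliques containing `S` form a complete block of that graph. Every
edge `{Q, Q'}` lies in the single block of `S = Q ∩ Q'`, and the identity `∑ (m_S - 1) + 1 =
#cliques`, with `m_S` the block sizes, says that the blocks are glued like a tree
(`IsKTree.isBlockPartition`). A spanning tree is therefore an independent choice of one tree on each
block (`natCard_spanningTrees`). So `S` labels `m_S - 1` edges of every clique tree, giving `μ(S) =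
m_S - 1`, and Cayley's formula (`numTrees_eq`) contributes `m_S ^ (m_S - 2) = (μ(S) + 1) ^ (μ(S) -
1)`.

Blocks of size one contribute a factor `1`. When `m_S ≥ 2`, `S` is a minimal separator
(`IsKTree.isMinimalVertexSeparator`), so the product may be taken over the minimal separators. -/

namespace KTreeClique

/-! ### Cayley's formula by inclusion-exclusion over leaves -/

section Cayley

open Finset

variable {α : Type*}

/-- The graph obtained from `T` by hanging a leaf `v` at `f v` for every `v ∈ S`. -/
def attachLeaves (S : Finset α) (T : SimpleGraph {x // x ∉ S}) (f : S → {x // x ∉ S}) :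
    SimpleGraph α :=
  T.map (Function.Embedding.subtype _) ⊔
    SimpleGraph.fromEdgeSet (Set.range fun v : S => s((v : α), (f v : α)))

variable {S : Finset α} {T : SimpleGraph {x // x ∉ S}} {f : S → {x // x ∉ S}}

lemma attachLeaves_adj_core (a b : {x // x ∉ S}) :
    (attachLeaves S T f).Adj a b ↔ T.Adj a b := by
  simp only [attachLeaves, SimpleGraph.sup_adj, SimpleGraph.fromEdgeSet_adj, Set.mem_range,
    Sym2.eq_iff]
  constructor
  · rintro (h | ⟨⟨v, h | h⟩, -⟩)
    · exact (SimpleGraph.map_adj_apply (f := Function.Embedding.subtype (· ∉ S))).1 h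
    · exact absurd (h.1 ▸ v.2) a.2
    · exact absurd (h.1 ▸ v.2) b.2
  · intro h
    exact .inl ((SimpleGraph.map_adj_apply (f := Function.Embedding.subtype (· ∉ S))).2 h)

lemma attachLeaves_adj_leaf (v : S) (b : α) :
    (attachLeaves S T f).Adj v b ↔ b = f v := by
  simp only [attachLeaves, SimpleGraph.sup_adj, SimpleGraph.fromEdgeSet_adj, Set.mem_range,
    Sym2.eq_iff, SimpleGraph.map_adj]
  constructor
  · rintro (⟨x, y, -, h, -⟩ | ⟨⟨w, h | h⟩, -⟩)
    · exact absurd (show (x : α) ∈ S from (show (x : α) = v from h) ▸ v.2) x.2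
    · rw [← h.2, Subtype.ext h.1]
    · exact absurd (h.2 ▸ v.2) (f w).2
  · rintro rfl
    exact Or.inr ⟨⟨v, Or.inl ⟨rfl, rfl⟩⟩, fun h => (f v).2 (h ▸ v.2)⟩

/-- Each hung vertex reaches the core, and each adds exactly one new edge, so connectedness and the
edge count `|α| - 1` both carry over. -/
lemma attachLeaves_isTree [Finite α] (hT : T.IsTree) : (attachLeaves S T f).IsTree := by
  classical
  have := Fintype.ofFinite α
  have hcore : ∀ a b : {x // x ∉ S}, (attachLeaves S T f).Reachable a b := fun a b =>
    (hT.connected a b).map ⟨Subtype.val, fun {a b} h => (attachLeaves_adj_core a b).2 h⟩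
  have hleaf : ∀ a, ∃ b : {x // x ∉ S}, (attachLeaves S T f).Reachable a b := by
    intro a
    by_cases ha : a ∈ S
    · exact ⟨f ⟨a, ha⟩, ((attachLeaves_adj_leaf ⟨a, ha⟩ _).2 rfl).reachable⟩
    · exact ⟨⟨a, ha⟩, .refl _⟩
  obtain ⟨r⟩ := hT.connected.nonempty
  have hne : Nonempty α := ⟨r⟩
  rw [SimpleGraph.isTree_iff_connected_and_card] at hT ⊢
  refine ⟨⟨fun a b => ?_⟩, ?_⟩
  · obtain ⟨a', ha⟩ := hleaf a
    obtain ⟨b', hb⟩ := hleaf b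
    exact ha.trans ((hcore a' b').trans hb.symm)
  · have hloop : Disjoint (Set.range fun v : S => s((v : α), (f v : α))) (Sym2.diagSet) := by
      rw [Set.disjoint_left]
      rintro _ ⟨v, rfl⟩ h
      exact (f v).2 ((show (v : α) = f v by simpa using h) ▸ v.2)
    have hE : (attachLeaves S T f).edgeSet =
        (Function.Embedding.subtype (· ∉ S)).sym2Map '' T.edgeSet ∪
          Set.range fun v : S => s((v : α), (f v : α)) := by
      rw [attachLeaves, SimpleGraph.edgeSet_sup, SimpleGraph.edgeSet_map,
        SimpleGraph.edgeSet_fromEdgeSet, hloop.sdiff_eq_left]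
    have hdisj : Disjoint ((Function.Embedding.subtype (· ∉ S)).sym2Map '' T.edgeSet)
        (Set.range fun v : S => s((v : α), (f v : α))) := by
      rw [Set.disjoint_left]
      rintro _ ⟨e, -, rfl⟩ ⟨v, hv⟩
      have : (v : α) ∈ Sym2.map Subtype.val e := by
        change s((v : α), (f v : α)) = Sym2.map Subtype.val e at hv
        rw [← hv]; simp
      obtain ⟨w, -, hw⟩ := Sym2.mem_map.1 this
      exact w.2 (hw ▸ v.2)
    have hinj : Function.Injective fun v : S => s((v : α), (f v : α)) := by
      intro v w h
      rcases Sym2.eq_iff.1 h with h | h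
      · exact Subtype.ext h.1
      · exact absurd (h.1 ▸ v.2) (f w).2
    have h1 : Nat.card (attachLeaves S T f).edgeSet = Nat.card T.edgeSet + #S := by
      rw [hE, Nat.card_coe_set_eq, Set.ncard_union_eq hdisj (Set.toFinite _) (Set.toFinite _),
        Set.ncard_image_of_injective _ (Function.Embedding.injective _), ← Nat.card_coe_set_eq,
        ← Nat.card_coe_set_eq, Nat.card_range_of_injective hinj]
      simp
    have h2 : Nat.card {x // x ∉ S} + #S = Nat.card α := by
      simp only [Nat.card_eq_fintype_card, Fintype.card_subtype_compl, Fintype.card_coe]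
      exact Nat.sub_add_cancel (card_le_univ S)
    omega

/-- The number of labelled trees on `n` vertices. -/
noncomputable def numTrees (n : ℕ) : ℕ := Nat.card {T : SimpleGraph (Fin n) // T.IsTree}

lemma natCard_isTree [Finite α] :
    Nat.card {T : SimpleGraph α // T.IsTree} = numTrees (Nat.card α) :=
  Nat.card_congr <| (Finite.equivFin α).simpleGraph.subtypeEquiv fun T =>
    (SimpleGraph.Iso.comap (Finite.equivFin α).symm T).isTree_iff.symm

/-- Two adjacent leaves are the whole connected graph. -/
lemma not_mem_of_leaf_adj [Finite α] {G : SimpleGraph α} (hG : G.Connected)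
    (h3 : 3 ≤ Nat.card α) (hS : ∀ v ∈ S, ∃! w, G.Adj v w) {v w : α} (hv : v ∈ S)
    (h : G.Adj v w) : w ∉ S := by
  intro hw
  have key : ∀ x, G.Reachable v x → x = v ∨ x = w := by
    rintro x ⟨p⟩
    induction p using SimpleGraph.Walk.concatRec with
    | Hnil => exact .inl rfl
    | @Hconcat a b c p hadj ih =>
      rcases ih hv h with rfl | rfl
      · exact .inr ((hS _ hv).unique hadj h)
      · exact .inl ((hS _ hw).unique hadj h.symm)
  have : (Set.univ : Set α) ⊆ {v, w} := fun x _ => key x (hG v x)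
  have := (Set.ncard_le_ncard this (Set.toFinite _)).trans (Set.ncard_insert_le _ _)
  rw [Set.ncard_univ, Set.ncard_singleton] at this
  omega

/-- Deleting the prescribed leaves leaves a tree on the complement together with the map sending
each leaf to its neighbour; `attachLeaves` is the inverse. Three vertices are needed so that no two
leaves are adjacent. -/
lemma natCard_isTree_leaves [Finite α] (h3 : 3 ≤ Nat.card α) (S : Finset α) :
    Nat.card {T : SimpleGraph α // T.IsTree ∧ ∀ v ∈ S, ∃! w, T.Adj v w} =
      (Nat.card α - #S) ^ #S * numTrees (Nat.card α - #S) := by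
  classical
  have := Fintype.ofFinite α
  have hc : Nat.card {x // x ∉ S} = Nat.card α - #S := by
    simp only [Nat.card_eq_fintype_card, Fintype.card_subtype_compl, Fintype.card_coe]
  have hfun : Nat.card (S → {x // x ∉ S}) = (Nat.card α - #S) ^ #S := by
    rw [Nat.card_fun, hc]; simp
  rw [← hfun, ← hc, ← natCard_isTree, ← Nat.card_prod]
  refine (Nat.card_congr (Equiv.ofBijective (fun p : (S → {x // x ∉ S}) ×
    {T : SimpleGraph {x // x ∉ S} // T.IsTree} => (⟨attachLeaves S p.2.1 p.1,
      attachLeaves_isTree p.2.2, fun v hv => ⟨p.1 ⟨v, hv⟩,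
        (attachLeaves_adj_leaf ⟨v, hv⟩ _).2 rfl, fun w hw =>
          (attachLeaves_adj_leaf ⟨v, hv⟩ _).1 hw⟩⟩ :
      {T : SimpleGraph α // T.IsTree ∧ ∀ v ∈ S, ∃! w, T.Adj v w})) ⟨?_, ?_⟩)).symm
  · rintro ⟨f, T, hT⟩ ⟨f', T', hT'⟩ h
    have h : attachLeaves S T f = attachLeaves S T' f' := congrArg Subtype.val h
    have hf : f = f' := by
      funext v
      have := (attachLeaves_adj_leaf (T := T) (f := f) v (f v)).2 rfl
      rw [h, attachLeaves_adj_leaf] at this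
      exact Subtype.ext this
    have hT : T = T' := by
      ext a b
      rw [← attachLeaves_adj_core (T := T) (f := f), h, attachLeaves_adj_core]
    subst hf hT
    rfl
  · rintro ⟨G, hG, hS⟩
    have hout : ∀ v : S, ∃ w : {x // x ∉ S}, G.Adj v w := fun v => by
      obtain ⟨w, hw, -⟩ := hS v v.2
      exact ⟨⟨w, not_mem_of_leaf_adj hG.connected h3 hS v.2 hw⟩, hw⟩
    choose f hf using hout
    have hne : Nonempty {x // x ∉ S} := by
      obtain ⟨a⟩ := hG.connected.nonempty
      by_cases ha : a ∈ S
      · exact ⟨f ⟨a, ha⟩⟩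
      · exact ⟨⟨a, ha⟩⟩
    have hT : (G.induce {x | x ∉ S}).IsTree :=
      ⟨@SimpleGraph.Connected.mk _ _ (hG.connected.preconnected.induce_of_degree_eq_one fun v hv x hx y hy =>
        (hS v (not_not.1 hv)).unique hx hy) hne, hG.isAcyclic.induce _⟩
    refine ⟨⟨f, G.induce {x | x ∉ S}, hT⟩, Subtype.ext ?_⟩
    have hleaf : ∀ (v : S) b, (attachLeaves S (G.induce {x | x ∉ S}) f).Adj v b ↔ G.Adj v b := by
      intro v b
      rw [attachLeaves_adj_leaf]
      exact ⟨fun h => h ▸ hf v, fun h => (hS v v.2).unique h (hf v)⟩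
    ext a b
    by_cases ha : a ∈ S
    · exact hleaf ⟨a, ha⟩ b
    by_cases hb : b ∈ S
    · rw [SimpleGraph.adj_comm, G.adj_comm]
      exact hleaf ⟨b, hb⟩ a
    · exact attachLeaves_adj_core (T := G.induce {x | x ∉ S}) ⟨a, ha⟩ ⟨b, hb⟩

/-- Swapping sums, each tree contributes the alternating sum over subsets of its leaf set, which
vanishes because every nontrivial tree has a leaf. -/
lemma sum_neg_one_pow_numTrees {n : ℕ} (hn : 3 ≤ n) :
    ∑ i ∈ range (n + 1), (-1 : ℤ) ^ i * n.choose i * ((n - i : ℕ) ^ i * numTrees (n - i)) = 0 := by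
  classical
  have h1 : ∀ S : Finset (Fin n), ((n - #S : ℕ) : ℤ) ^ #S * numTrees (n - #S) =
      ∑ T : {T : SimpleGraph (Fin n) // T.IsTree},
        if S ⊆ univ.filter (fun v => ∃! w, T.1.Adj v w) then 1 else 0 := by
    intro S
    have := natCard_isTree_leaves (α := Fin n) (by simpa using hn) S
    rw [Nat.card_fin] at this
    rw [← Nat.cast_pow, ← Nat.cast_mul, ← this, sum_boole, ← Fintype.card_subtype,
      ← Nat.card_eq_fintype_card]
    congr 1
    refine Nat.card_congr ((Equiv.subtypeSubtypeEquivSubtypeInter _ _).symm.trans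
      (Equiv.subtypeEquivRight fun T => ?_))
    simp [subset_iff]
  have h2 : ∑ S : Finset (Fin n), (-1 : ℤ) ^ #S * ((n - #S : ℕ) ^ #S * numTrees (n - #S)) = 0 := by
    simp_rw [h1, mul_sum]
    rw [sum_comm]
    refine sum_eq_zero fun T _ => ?_
    simp_rw [mul_ite, mul_one, mul_zero]
    rw [← sum_filter]
    have : Nontrivial (Fin n) := Fin.nontrivial_iff_two_le.2 (by omega)
    obtain ⟨v, hv⟩ := T.2.exists_vert_degree_one_of_nontrivial
    rw [SimpleGraph.degree_eq_one_iff_existsUnique_adj] at hv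
    rw [← sum_powerset_neg_one_pow_card_of_nonempty
      (x := univ.filter (fun v => ∃! w, T.1.Adj v w)) ⟨v, by simpa using hv⟩]
    refine sum_congr ?_ fun _ _ => rfl
    ext S
    simp
  rw [← h2, ← powerset_univ, sum_powerset_apply_card
    (fun i => (-1 : ℤ) ^ i * ((n - i : ℕ) ^ i * numTrees (n - i)))]
  simp only [card_univ, Fintype.card_fin, nsmul_eq_mul]
  exact sum_congr rfl fun i _ => by ring

/-- This is the `n`-th finite difference of a polynomial of degree `n - 2`. It is the recurrence of
`sum_neg_one_pow_numTrees` with `n ^ (n - 2)` in place of `numTrees n`. -/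
lemma sum_neg_one_pow_sub_pow {n : ℕ} (hn : 2 ≤ n) :
    ∑ i ∈ range (n + 1), (-1 : ℤ) ^ i * n.choose i * (n - i : ℕ) ^ (n - 2) = 0 := by
  have h := congrFun (fwdDiff_iter_pow_eq_zero_of_lt (R := ℤ) (j := n - 2) (n := n) (by omega)) 0
  rw [fwdDiff_iter_eq_sum_shift] at h
  rw [← sum_range_reflect, ← Pi.zero_apply (M := fun _ : ℤ => ℤ) (0 : ℤ), ← h]
  refine sum_congr rfl fun i hi => ?_
  have hi : i ≤ n := by simpa [Nat.lt_succ_iff] using hi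
  have e : n + 1 - 1 - i = n - i := by omega
  rw [e, Nat.sub_sub_self hi, Nat.choose_symm hi]
  simp

/-- **Cayley's formula**. -/
theorem numTrees_eq {n : ℕ} (hn : 1 ≤ n) : numTrees n = n ^ (n - 2) := by
  induction n using Nat.strong_induction_on with
  | _ n ih =>
  have hsub : n ≤ 1 → numTrees n = 1 := by
    intro h
    obtain rfl : n = 1 := by omega
    have : Unique {T : SimpleGraph (Fin 1) // T.IsTree} :=
      ⟨⟨⟨⊥, .of_subsingleton⟩⟩, fun T => Subtype.ext (Subsingleton.elim _ _)⟩
    exact Nat.card_unique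
  have htwo : n = 2 → numTrees n = 1 := by
    rintro rfl
    have htop : (⊤ : SimpleGraph (Fin 2)).IsTree :=
      ⟨SimpleGraph.connected_top, .of_card_le_two (by simp)⟩
    have : Unique {T : SimpleGraph (Fin 2) // T.IsTree} := by
      refine ⟨⟨⟨⊤, htop⟩⟩, fun T => Subtype.ext ?_⟩
      exact ((SimpleGraph.isTree_iff_minimal_connected.1 htop).eq_of_le T.2.connected le_top)
    exact Nat.card_unique
  by_cases h3 : 3 ≤ n
  · have hz : numTrees 0 = 0 := by
      have : IsEmpty {T : SimpleGraph (Fin 0) // T.IsTree} :=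
        ⟨fun T => T.2.connected.nonempty.elim Fin.elim0⟩
      exact Nat.card_of_isEmpty
    have h := (sum_neg_one_pow_numTrees h3).trans
      (sum_neg_one_pow_sub_pow (n := n) (by omega)).symm
    rw [sum_range_succ', sum_range_succ' (fun i => (-1 : ℤ) ^ i * n.choose i * _)] at h
    have hs : ∀ i ∈ range n, (-1 : ℤ) ^ (i + 1) * n.choose (i + 1) *
        ((n - (i + 1) : ℕ) ^ (i + 1) * numTrees (n - (i + 1))) =
        (-1 : ℤ) ^ (i + 1) * n.choose (i + 1) * (n - (i + 1) : ℕ) ^ (n - 2) := by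
      intro i hi
      have hi : i < n := mem_range.1 hi
      congr 1
      -- With no vertices left both terms vanish, the right one because `n - 2 > 0`. With one vertex
      -- left the truncated exponent `1 - 2` does not add up, but both bases are `1`. Otherwise the
      -- exponents add to `n - 2`.
      obtain h0 | h0 := Nat.eq_zero_or_pos (n - (i + 1))
      · rw [h0, hz]
        simp [show n - 2 ≠ 0 by omega]
      · rw [ih _ (by omega) h0]
        push_cast
        obtain h1 | h1 := Nat.eq_or_lt_of_le (Nat.succ_le_of_lt h0)
        · rw [← h1]; simp
        · rw [← pow_add]; congr 1; omega
    rw [sum_congr rfl hs] at h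
    have h := add_left_cancel h
    simp only [pow_zero, Nat.choose_zero_right, Nat.cast_one, Nat.sub_zero, one_mul] at h
    exact_mod_cast h
  · obtain h | h : n ≤ 1 ∨ n = 2 := by omega
    · rw [hsub h, show n - 2 = 0 by omega, pow_zero]
    · rw [htwo h, h]; rfl

end Cayley

/-! ### Cliques and separations in `k`-trees, by induction on the construction -/

section KTrees

open Finset

variable {V : Type*} [DecidableEq V] {k : ℕ} {G : SimpleGraph V} {s : Finset V}

lemma subset_insert_of_isClique {C A : Finset V} {v : V} (hA : G.IsClique (A : Set V))
    (hAs : A ⊆ insert v s) (hadj : ∀ w ∈ s, G.Adj v w ↔ w ∈ C) (hvA : v ∈ A) :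
    A ⊆ insert v C := by
  intro w hw
  by_cases h : w = v
  · simp [h]
  · exact mem_insert_of_mem ((hadj w (mem_of_mem_insert_of_ne (hAs hw) h)).1
      (hA hvA hw (Ne.symm h)))

lemma isNClique_insert_of_step {C : Finset V} {v : V} (hCs : C ⊆ s) (hC : G.IsNClique k C)
    (hadj : ∀ w ∈ s, G.Adj v w ↔ w ∈ C) : G.IsNClique (k + 1) (insert v C) :=
  hC.insert fun w hw => (hadj w (hCs hw)).2 hw

/-- Every clique of a `k`-tree lies in a `(k + 1)`-clique. -/
lemma IsKTreeOn.exists_superset (h : IsKTreeOn k G s) {A : Finset V} (hAs : A ⊆ s)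
    (hA : G.IsClique (A : Set V)) : ∃ Q ⊆ s, G.IsNClique (k + 1) Q ∧ A ⊆ Q := by
  induction h generalizing A with
  | base s hs => exact ⟨s, Subset.rfl, hs, hAs⟩
  | step s C v _ hv hCs hC hadj ih =>
    by_cases hvA : v ∈ A
    · exact ⟨insert v C, insert_subset_insert v hCs, isNClique_insert_of_step hCs hC hadj,
        subset_insert_of_isClique hA hAs hadj hvA⟩
    · obtain ⟨Q, hQs, hQ, hAQ⟩ := ih ((subset_insert_iff_of_notMem hvA).1 hAs) hA
      exact ⟨Q, hQs.trans (subset_insert _ _), hQ, hAQ⟩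

/-- A clique through the new vertex lies in `insert v C`, so each construction step creates exactly
one new `(k + 1)`-clique. -/
lemma isNClique_subset_insert_iff {C Q : Finset V} {v : V} (hCs : C ⊆ s)
    (hC : G.IsNClique k C) (hadj : ∀ w ∈ s, G.Adj v w ↔ w ∈ C) :
    Q ⊆ insert v s ∧ G.IsNClique (k + 1) Q ↔
      Q = insert v C ∨ Q ⊆ s ∧ G.IsNClique (k + 1) Q := by
  have hvC := isNClique_insert_of_step hCs hC hadj
  constructor
  · rintro ⟨hQs, hQ⟩
    by_cases hvQ : v ∈ Q
    · exact .inl (eq_of_subset_of_card_le (subset_insert_of_isClique hQ.isClique hQs hadj hvQ)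
        (by rw [hvC.card_eq, hQ.card_eq]))
    · exact .inr ⟨(subset_insert_iff_of_notMem hvQ).1 hQs, hQ⟩
  · rintro (rfl | ⟨hQs, hQ⟩)
    · exact ⟨insert_subset_insert v hCs, hvC⟩
    · exact ⟨hQs.trans (subset_insert _ _), hQ⟩

/-- The `(k + 1)`-cliques of a `k`-tree are linked by steps exchanging a single vertex. -/
lemma IsKTreeOn.exists_reflTransGen (h : IsKTreeOn k G s) :
    ∃ Q₀, G.IsNClique (k + 1) Q₀ ∧ ∀ Q ⊆ s, G.IsNClique (k + 1) Q →
      Relation.ReflTransGen (fun A B => G.IsNClique (k + 1) B ∧ #(A ∩ B) = k) Q₀ Q := by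
  induction h with
  | base s hs =>
    refine ⟨s, hs, fun Q hQs hQ => ?_⟩
    rw [eq_of_subset_of_card_le hQs (by rw [hs.card_eq, hQ.card_eq])]
  | step s C v hs hv hCs hC hadj ih =>
    obtain ⟨Q₀, hQ₀, ih⟩ := ih
    refine ⟨Q₀, hQ₀, fun Q hQs hQ => ?_⟩
    rcases (isNClique_subset_insert_iff hCs hC hadj).1 ⟨hQs, hQ⟩ with rfl | ⟨hQs, -⟩
    · obtain ⟨R, hRs, hR, hCR⟩ := hs.exists_superset hCs hC.isClique
      refine (ih R hRs hR).tail ⟨hQ, ?_⟩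
      rw [inter_insert_of_notMem fun h => hv (hRs h), inter_eq_right.2 hCR, hC.card_eq]
    · exact ih Q hQs hQ

-- This count makes the blocks tree-like. A construction step adds one clique and raises only the
-- summand of `C`, by one. Truncated subtraction makes `k`-sets lying in no clique contribute `0`.
open scoped Classical in
lemma IsKTreeOn.sum_card_sub_one [Fintype V] (h : IsKTreeOn k G s) :
    ∑ S ∈ powersetCard k (univ : Finset V),
      (#{Q | (Q ⊆ s ∧ G.IsNClique (k + 1) Q) ∧ S ⊆ Q} - 1) + 1 =
    #{Q | Q ⊆ s ∧ G.IsNClique (k + 1) Q} := by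
  induction h with
  | base s hs =>
    have hQ : ∀ Q, Q ⊆ s ∧ G.IsNClique (k + 1) Q ↔ Q = s := fun Q =>
      ⟨fun h => eq_of_subset_of_card_le h.1 (by rw [hs.card_eq, h.2.card_eq]),
        by rintro rfl; exact ⟨Subset.rfl, hs⟩⟩
    simp only [hQ]
    rw [sum_eq_zero fun S _ => ?_]
    · simp [filter_eq']
    · refine Nat.sub_eq_zero_of_le ((card_le_card (filter_subset_filter _ (subset_univ _))).trans
        (card_le_one.2 ?_))
      simp +contextual
  | step s C v hs hv hCs hC hadj ih =>
    simp only [isNClique_subset_insert_iff hCs hC hadj]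
    have hnot : ¬ (insert v C ⊆ s ∧ G.IsNClique (k + 1) (insert v C)) :=
      fun h => hv (h.1 (mem_insert_self _ _))
    have hM : #{Q | Q = insert v C ∨ Q ⊆ s ∧ G.IsNClique (k + 1) Q} =
        #{Q | Q ⊆ s ∧ G.IsNClique (k + 1) Q} + 1 := by
      rw [← card_insert_of_notMem (a := insert v C) (by simpa using hnot)]
      congr 1
      ext Q
      simp
    have hS : ∀ S ∈ powersetCard k (univ : Finset V),
        #{Q | (Q = insert v C ∨ Q ⊆ s ∧ G.IsNClique (k + 1) Q) ∧ S ⊆ Q} - 1 =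
        (#{Q | (Q ⊆ s ∧ G.IsNClique (k + 1) Q) ∧ S ⊆ Q} - 1) + if S = C then 1 else 0 := by
      intro S hS
      have hSk : #S = k := (mem_powersetCard.1 hS).2
      by_cases hSC : S ⊆ insert v C
      · have : #{Q | (Q = insert v C ∨ Q ⊆ s ∧ G.IsNClique (k + 1) Q) ∧ S ⊆ Q} =
            #{Q | (Q ⊆ s ∧ G.IsNClique (k + 1) Q) ∧ S ⊆ Q} + 1 := by
          rw [← card_insert_of_notMem (a := insert v C) (by
            simpa using fun h h' => absurd ⟨h, h'⟩ hnot)]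
          congr 1
          ext Q
          simp only [mem_filter, mem_univ, true_and, mem_insert]
          constructor
          · rintro ⟨h | h, h'⟩ <;> tauto
          · rintro (rfl | h) <;> tauto
        rw [this, Nat.add_sub_cancel]
        -- If `v ∈ S`, the count goes from `0` to `1` and the truncated summand stays `0`. If `S =
        -- C`, an old clique already contains `S`, so the summand really increases.
        by_cases hvS : v ∈ S
        · have hz : #{Q | (Q ⊆ s ∧ G.IsNClique (k + 1) Q) ∧ S ⊆ Q} = 0 := by
            rw [card_eq_zero, filter_eq_empty_iff]
            exact fun Q _ h => hv (h.1.1 (h.2 hvS))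
          rw [hz, if_neg]
          rintro rfl
          exact hv (hCs hvS)
        · obtain rfl : S = C := eq_of_subset_of_card_le
            ((subset_insert_iff_of_notMem hvS).1 hSC) (by rw [hC.card_eq, hSk])
          obtain ⟨Q, hQs, hQ, hSQ⟩ := hs.exists_superset hCs hC.isClique
          have : 0 < #{Q | (Q ⊆ s ∧ G.IsNClique (k + 1) Q) ∧ S ⊆ Q} :=
            card_pos.2 ⟨Q, by simp [hQs, hQ, hSQ]⟩
          rw [if_pos rfl]
          omega
      · rw [if_neg (by rintro rfl; exact hSC (subset_insert _ _)), add_zero]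
        congr 2
        ext Q
        simp only [mem_filter, mem_univ, true_and]
        constructor
        · rintro ⟨rfl | h, h'⟩ <;> tauto
        · tauto
    rw [hM, ← ih, sum_congr rfl hS, sum_add_distrib, sum_ite_eq', if_pos]
    exact mem_powersetCard.2 ⟨subset_univ _, hC.card_eq⟩

/-- Two `(k + 1)`-cliques of a `k`-tree sharing `k` vertices are separated by these vertices. -/
lemma IsKTreeOn.exists_separation (h : IsKTreeOn k G s) {S : Finset V} {u v : V} (huS : u ∉ S)
    (hvS : v ∉ S) (huv : u ≠ v) (hu : G.IsNClique (k + 1) (insert u S))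
    (hv : G.IsNClique (k + 1) (insert v S)) (hus : insert u S ⊆ s) (hvs : insert v S ⊆ s) :
    ∃ A : Set V, u ∈ A ∧ v ∉ A ∧ ∀ a ∈ A, a ∈ s ∧ a ∉ S ∧ ∀ b ∈ s, b ∉ S → G.Adj a b → b ∈ A := by
  have hSk : #S = k := by
    have := hu.card_eq
    rw [card_insert_of_notMem huS] at this
    omega
  have hne : insert u S ≠ insert v S := fun h =>
    (mem_insert.1 (h ▸ mem_insert_self u S)).elim huv huS
  induction h with
  | base s hs =>
    exact absurd ((eq_of_subset_of_card_le hus (by rw [hs.card_eq, hu.card_eq])).trans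
      (eq_of_subset_of_card_le hvs (by rw [hs.card_eq, hv.card_eq])).symm) hne
  | step s C x hs hx hCs hC hadj ih =>
    have hq := isNClique_subset_insert_iff (Q := insert u S) hCs hC hadj
    have hq' := isNClique_subset_insert_iff (Q := insert v S) hCs hC hadj
    have hSC : ∀ w ∉ S, insert w S = insert x C → x ∉ S → w = x ∧ S = C := by
      intro w hwS h hxS
      obtain rfl : x = w := by
        have := h.symm ▸ mem_insert_self x C
        simpa [hxS] using this
      refine ⟨rfl, eq_of_subset_of_card_le (fun y hy => ?_) (by rw [hC.card_eq, hSk])⟩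
      exact mem_of_mem_insert_of_ne (h ▸ mem_insert_of_mem hy) (by rintro rfl; exact hxS hy)
    rcases hq.1 ⟨hus, hu⟩ with h | ⟨hus', -⟩
    · rcases hq'.1 ⟨hvs, hv⟩ with h' | ⟨hvs', -⟩
      · exact absurd (h.trans h'.symm) hne
      have hxS : x ∉ S := fun h => hx (hvs' (mem_insert_of_mem h))
      obtain ⟨rfl, rfl⟩ := hSC u huS h hxS
      refine ⟨{u}, rfl, huv.symm, ?_⟩
      rintro a rfl
      refine ⟨mem_insert_self _ _, huS, fun b hb hbS hab => ?_⟩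
      rcases mem_insert.1 hb with rfl | hb
      · rfl
      · exact absurd ((hadj b hb).1 hab) hbS
    · have hxS : x ∉ S := fun h => hx (hus' (mem_insert_of_mem h))
      rcases hq'.1 ⟨hvs, hv⟩ with h' | ⟨hvs', -⟩
      · obtain ⟨rfl, rfl⟩ := hSC v hvS h' hxS
        refine ⟨{a | a ∈ s ∧ a ∉ S}, ⟨hus' (mem_insert_self _ _), huS⟩, fun h => hx h.1, ?_⟩
        rintro a ⟨has, haS⟩
        refine ⟨mem_insert_of_mem has, haS, fun b hb hbS hab => ?_⟩
        rcases mem_insert.1 hb with rfl | hb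
        · exact absurd ((hadj a has).1 hab.symm) haS
        · exact ⟨hb, hbS⟩
      · obtain ⟨A, huA, hvA, hA⟩ := ih hus' hvs'
        -- The new vertex `x` joins the side `A` exactly when its attaching clique `C` meets `A`.
        -- Since `C` is a clique, all of `C` outside `S` then lies in `A`.
        have hvx : v ≠ x := fun h => hx (h ▸ hvs' (mem_insert_self _ _))
        refine ⟨{a | a ∈ A ∧ a ≠ x ∨ a = x ∧ ∃ c ∈ C, c ∈ A},
          .inl ⟨huA, fun h => hx (h ▸ hus' (mem_insert_self _ _))⟩, ?_, ?_⟩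
        · rintro (h | h)
          · exact hvA h.1
          · exact hvx h.1
        rintro a (⟨ha, hax⟩ | ⟨rfl, c, hcC, hcA⟩)
        · refine ⟨mem_insert_of_mem (hA a ha).1, (hA a ha).2.1, fun b hb hbS hab => ?_⟩
          rcases mem_insert.1 hb with rfl | hbs
          · exact .inr ⟨rfl, a, (hadj a (hA a ha).1).1 hab.symm, ha⟩
          · exact .inl ⟨(hA a ha).2.2 b hbs hbS hab, fun h => hx (h ▸ hbs)⟩
        · refine ⟨mem_insert_self _ _, hxS, fun b hb hbS hab => ?_⟩
          rcases mem_insert.1 hb with rfl | hbs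
          · exact absurd hab G.irrefl
          · have hbC := (hadj b hbs).1 hab
            refine .inl ⟨?_, hab.ne'⟩
            by_cases hcb : c = b
            · exact hcb ▸ hcA
            · exact (hA c hcA).2.2 b hbs hbS (hC.isClique hcC hbC hcb)

end KTrees

/-! ### Spanning trees of a graph glued from complete blocks -/

section CliquePartition

open Finset

variable {X ι : Type*} [Finite X]

lemma card_edgeFinset_add_one {T : SimpleGraph X} [Fintype T.edgeSet] (hT : T.IsTree) :
    #T.edgeFinset + 1 = Nat.card X := by
  rw [← (SimpleGraph.isTree_iff_connected_and_card.1 hT).2, SimpleGraph.edgeFinset_card,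
    Nat.card_eq_fintype_card]

/-- A forest extends to a tree on all of `X`, and equals it when the edge counts agree. -/
lemma natCard_edgeSet_add_one_le_of_isAcyclic [Nonempty X] {F : SimpleGraph X}
    (hF : F.IsAcyclic) : Nat.card F.edgeSet + 1 ≤ Nat.card X ∧
      (Nat.card F.edgeSet + 1 = Nat.card X → F.IsTree) := by
  obtain ⟨T, hFT, -, hT⟩ :=
    SimpleGraph.connected_top.exists_isTree_le_of_le_of_isAcyclic le_top hF
  have hcard := (SimpleGraph.isTree_iff_connected_and_card.1 hT).2
  have hsub := SimpleGraph.edgeSet_mono hFT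
  rw [Nat.card_coe_set_eq] at hcard ⊢
  refine ⟨hcard ▸ Nat.succ_le_succ (Set.ncard_le_ncard hsub (Set.toFinite _)), fun h => ?_⟩
  have := Set.eq_of_subset_of_ncard_le hsub (by omega) (Set.toFinite _)
  rwa [SimpleGraph.edgeSet_inj.1 this]

/-- The sets `M i` are cliques of `H` partitioning its edges, glued in a tree-like way. -/
structure IsBlockPartition (H : SimpleGraph X) (M : ι → Set X) [Fintype ι] : Prop where
  nonempty : ∀ i, Nonempty (M i)
  connected : H.Connected
  adj_iff : ∀ a b, H.Adj a b ↔ a ≠ b ∧ ∃ i, a ∈ M i ∧ b ∈ M i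
  eq_of_mem : ∀ i j a b, a ≠ b → a ∈ M i → b ∈ M i → a ∈ M j → b ∈ M j → i = j
  card_eq : ∑ i, (Nat.card (M i) - 1) + 1 = Nat.card X

namespace IsBlockPartition

variable [Fintype ι] {H T : SimpleGraph X} {M : ι → Set X}

lemma natCard_edgeSet (h : IsBlockPartition H M) (hT : T ≤ H) :
    Nat.card T.edgeSet = ∑ i, Nat.card (T.induce (M i)).edgeSet := by
  rw [← Nat.card_sigma]
  let φ : ∀ i, (T.induce (M i)).edgeSet → T.edgeSet := fun i =>
    (SimpleGraph.Embedding.induce (M i)).toHom.mapEdgeSet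
  refine (Nat.card_congr (Equiv.ofBijective (fun p : Σ i, (T.induce (M i)).edgeSet => φ p.1 p.2)
    ⟨?_, ?_⟩)).symm
  · rintro ⟨i, e, he⟩ ⟨j, e', he'⟩ hee
    have hee : e.map Subtype.val = e'.map Subtype.val := congrArg Subtype.val hee
    obtain rfl : i = j := by
      induction e with | _ a b =>
      have hab : (a : X) ≠ b := fun h' =>
        ((SimpleGraph.mem_edgeSet _).1 he).ne (Subtype.ext h')
      have hmem : ∀ x ∈ s((a : X), (b : X)), x ∈ M j := by
        intro x hx
        rw [← Sym2.map_mk, hee] at hx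
        obtain ⟨y, -, rfl⟩ := Sym2.mem_map.1 hx
        exact y.2
      exact h.eq_of_mem i j a b hab a.2 b.2 (hmem _ (by simp)) (hmem _ (by simp))
    obtain rfl := Sym2.map.injective Subtype.val_injective hee
    rfl
  · rintro ⟨e, he⟩
    induction e with | _ a b =>
    obtain ⟨-, i, ha, hb⟩ := (h.adj_iff a b).1 (hT he)
    exact ⟨⟨i, s(⟨a, ha⟩, ⟨b, hb⟩), he⟩, rfl⟩

/-- On each block `T` is a forest with at most `|M i| - 1` edges. By `card_eq` these bounds sum to
the `|X| - 1` edges of `T`, so each is attained. -/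
lemma isTree_induce (h : IsBlockPartition H M) (hT : T ≤ H) (hTree : T.IsTree) (i : ι) :
    (T.induce (M i)).IsTree := by
  have := h.nonempty
  have hle := fun j => natCard_edgeSet_add_one_le_of_isAcyclic (hTree.isAcyclic.induce (M j))
  refine (hle i).2 ?_
  have hsum : ∑ j, Nat.card (T.induce (M j)).edgeSet = ∑ j, (Nat.card (M j) - 1) := by
    rw [← h.natCard_edgeSet hT]
    have := (SimpleGraph.isTree_iff_connected_and_card.1 hTree).2
    have := h.card_eq
    omega
  have := (sum_eq_sum_iff_of_le fun j _ => by have := (hle j).1; omega).1 hsum i (mem_univ i)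
  have := (hle i).1
  omega

/-- Spanning trees of `H` restrict bijectively to families of trees on the blocks. -/
lemma natCard_spanningTrees (h : IsBlockPartition H M) :
    Nat.card {T : SimpleGraph X // T ≤ H ∧ T.IsTree} = ∏ i, numTrees (Nat.card (M i)) := by
  simp_rw [← natCard_isTree]
  rw [← Nat.card_pi]
  refine Nat.card_congr (Equiv.ofBijective (fun T i => ⟨T.1.induce (M i),
    h.isTree_induce T.2.1 T.2.2 i⟩) ⟨?_, ?_⟩)
  · rintro ⟨T, hT, hT'⟩ ⟨U, hU, hU'⟩ hTU
    have hTU : ∀ i, T.induce (M i) = U.induce (M i) := fun i =>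
      congrArg Subtype.val (congrFun hTU i)
    have hadj : ∀ i a b, a ∈ M i → b ∈ M i → (T.Adj a b ↔ U.Adj a b) := fun i a b ha hb => by
      have := congrArg (fun F : SimpleGraph (M i) => F.Adj ⟨a, ha⟩ ⟨b, hb⟩) (hTU i)
      exact this.to_iff
    refine Subtype.ext (SimpleGraph.ext ?_)
    funext a b
    refine propext ⟨fun hab => ?_, fun hab => ?_⟩
    · obtain ⟨-, i, ha, hb⟩ := (h.adj_iff a b).1 (hT hab)
      exact (hadj i a b ha hb).1 hab
    · obtain ⟨-, i, ha, hb⟩ := (h.adj_iff a b).1 (hU hab)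
      exact (hadj i a b ha hb).2 hab
  · intro F
    let T : SimpleGraph X :=
      { Adj := fun a b => ∃ i, ∃ (ha : a ∈ M i) (hb : b ∈ M i), (F i).1.Adj ⟨a, ha⟩ ⟨b, hb⟩
        symm := ⟨fun a b ⟨i, ha, hb, hab⟩ => ⟨i, hb, ha, hab.symm⟩⟩
        loopless := ⟨fun a ⟨i, _, _, hab⟩ => hab.ne rfl⟩ }
    have hTH : T ≤ H := by
      rintro a b ⟨i, ha, hb, hab⟩
      exact (h.adj_iff a b).2 ⟨fun e => hab.ne (Subtype.ext e), i, ha, hb⟩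
    have hind : ∀ i, T.induce (M i) = (F i).1 := by
      intro i
      ext a b
      constructor
      · rintro ⟨j, ha, hb, hab⟩
        obtain rfl := h.eq_of_mem i j a b (fun e => hab.ne (Subtype.ext e)) a.2 b.2 ha hb
        exact hab
      · intro hab
        exact ⟨i, a.2, b.2, hab⟩
    have hblock : ∀ i a b, a ∈ M i → b ∈ M i → T.Reachable a b := fun i a b ha hb =>
      ((F i).2.connected ⟨a, ha⟩ ⟨b, hb⟩).map
        (⟨Subtype.val, fun {x y} hxy => ⟨i, x.2, y.2, hxy⟩⟩ : (F i).1 →g T)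
    have hconn : T.Connected := by
      have := h.connected.nonempty
      refine ⟨fun a b => ?_⟩
      obtain ⟨p⟩ := h.connected a b
      induction p with
      | nil => exact .refl _
      | cons hadj _ ih =>
        obtain ⟨-, i, ha, hb⟩ := (h.adj_iff _ _).1 hadj
        exact (hblock i _ _ ha hb).trans ih
    -- The union of the block trees is connected, so `card_eq` gives the tree property by counting
    -- edges, without a direct look at cycles.
    have hTree : T.IsTree := by
      refine SimpleGraph.isTree_iff_connected_and_card.2 ⟨hconn, ?_⟩
      rw [h.natCard_edgeSet hTH, ← h.card_eq]
      congr 1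
      refine sum_congr rfl fun i _ => ?_
      rw [hind, ← (SimpleGraph.isTree_iff_connected_and_card.1 (F i).2).2]
      rfl
    exact ⟨⟨T, hTH, hTree⟩, funext fun i => Subtype.ext (hind i)⟩

end IsBlockPartition

end CliquePartition

/-! ### Clique trees, multiplicities and the final count -/

section CliqueTrees

open Finset

variable {V : Type*} [DecidableEq V] {k : ℕ} {G : SimpleGraph V}

/-- Maximal cliques are joined when they share exactly `k` vertices. -/
def ridgeGraph (k : ℕ) (G : SimpleGraph V) : SimpleGraph (MaxClique G) where
  Adj Q Q' := Q ≠ Q' ∧ #(Q.1 ∩ Q'.1) = k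
  symm := ⟨fun Q Q' h => ⟨h.1.symm, by rw [inter_comm]; exact h.2⟩⟩
  loopless := ⟨fun _ h => h.1 rfl⟩

lemma ridgeGraph_le (hk : 1 ≤ k) : ridgeGraph k G ≤ cliqueIntersectionGraph G :=
  fun _ _ h => ⟨h.1, card_pos.1 (by rw [h.2]; exact hk)⟩

lemma le_ridgeGraph_iff {T : SimpleGraph (MaxClique G)} :
    T ≤ ridgeGraph k G ↔ ∀ e ∈ T.edgeSet, #(edgeInter G e) = k := by
  constructor
  · intro h e he
    induction e with | _ Q Q' =>
    exact (h he).2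
  · intro h Q Q' hQ
    exact ⟨hQ.ne, h s(Q, Q') hQ⟩

/-- The maximal cliques containing `S`. -/
def cliquesOver (G : SimpleGraph V) (S : Finset V) : Set (MaxClique G) := {Q | S ⊆ Q.1}

/-- The `k`-sets of vertices contained in some maximal clique. -/
abbrev Ridge (k : ℕ) (G : SimpleGraph V) : Type _ :=
  {S : Finset V // #S = k ∧ (cliquesOver G S).Nonempty}

variable [Fintype V]

lemma IsKTree.maximal_isClique_iff (hG : IsKTree k G) {Q : Finset V} :
    Maximal (fun s : Finset V => G.IsClique (s : Set V)) Q ↔ G.IsNClique (k + 1) Q := by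
  constructor
  · intro hQ
    obtain ⟨R, -, hR, hQR⟩ := hG.exists_superset (subset_univ Q) hQ.prop
    rwa [hQ.eq_of_le hR.isClique hQR]
  · intro hQ
    refine ⟨hQ.isClique, fun A hA hQA => ?_⟩
    obtain ⟨R, -, hR, hAR⟩ := hG.exists_superset (subset_univ A) hA
    rwa [eq_of_subset_of_card_le (hQA.trans hAR) (by rw [hQ.card_eq, hR.card_eq])]

lemma IsKTree.isNClique (hG : IsKTree k G) (Q : MaxClique G) : G.IsNClique (k + 1) Q.1 :=
  hG.maximal_isClique_iff.1 Q.2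

lemma IsKTree.card_inter_le (hG : IsKTree k G) {Q Q' : MaxClique G} (h : Q ≠ Q') :
    #(Q.1 ∩ Q'.1) ≤ k := by
  by_contra! hk
  have hQ := eq_of_subset_of_card_le (inter_subset_left (s₁ := Q.1) (s₂ := Q'.1))
    (by rw [(hG.isNClique Q).card_eq]; omega)
  have hQ' := eq_of_subset_of_card_le (inter_subset_right (s₁ := Q.1) (s₂ := Q'.1))
    (by rw [(hG.isNClique Q').card_eq]; omega)
  exact h (Subtype.ext (hQ.symm.trans hQ'))

lemma IsKTree.inter_eq (hG : IsKTree k G) {Q Q' : MaxClique G} (h : Q ≠ Q') {S : Finset V}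
    (hS : #S = k) (hQ : S ⊆ Q.1) (hQ' : S ⊆ Q'.1) : Q.1 ∩ Q'.1 = S :=
  (eq_of_subset_of_card_le (subset_inter hQ hQ') (by rw [hS]; exact hG.card_inter_le h)).symm

lemma IsKTree.ridgeGraph_connected (hG : IsKTree k G) : (ridgeGraph k G).Connected := by
  obtain ⟨Q₀, hQ₀, h⟩ := IsKTreeOn.exists_reflTransGen hG
  rw [← hG.maximal_isClique_iff] at hQ₀
  have hr : ∀ Q, Relation.ReflTransGen (fun A B => G.IsNClique (k + 1) B ∧ #(A ∩ B) = k) Q₀ Q →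
      ∃ hQ, (ridgeGraph k G).Reachable ⟨Q₀, hQ₀⟩ ⟨Q, hQ⟩ := by
    intro Q hQ
    induction hQ with
    | refl => exact ⟨hQ₀, .refl _⟩
    | @tail A B _ hAB ih =>
      obtain ⟨hA, ih⟩ := ih
      refine ⟨hG.maximal_isClique_iff.2 hAB.1,
        ih.trans (SimpleGraph.Adj.reachable ⟨fun e => ?_, hAB.2⟩)⟩
      have e : A = B := congrArg Subtype.val e
      have := hAB.1.card_eq
      have := hAB.2
      rw [e, inter_self] at this
      omega
  have hr : ∀ Q : MaxClique G, (ridgeGraph k G).Reachable ⟨Q₀, hQ₀⟩ Q := fun Q =>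
    (hr Q.1 (h Q.1 (subset_univ _) (hG.isNClique Q))).2
  have : Nonempty (MaxClique G) := ⟨⟨Q₀, hQ₀⟩⟩
  exact ⟨fun Q Q' => (hr Q).symm.trans (hr Q')⟩

open scoped Classical in
lemma IsKTree.natCard_cliquesOver (hG : IsKTree k G) (S : Finset V) :
    Nat.card (cliquesOver G S) = #{Q | (Q ⊆ univ ∧ G.IsNClique (k + 1) Q) ∧ S ⊆ Q} := by
  rw [← Fintype.card_subtype, ← Nat.card_eq_fintype_card]
  refine Nat.card_congr ((Equiv.subtypeSubtypeEquivSubtypeInter _ (fun Q => S ⊆ Q)).trans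
    (Equiv.subtypeEquivRight fun Q => ?_))
  simp [hG.maximal_isClique_iff]

open scoped Classical in
lemma IsKTree.isBlockPartition (hG : IsKTree k G) :
    IsBlockPartition (ridgeGraph k G) (fun S : Ridge k G => cliquesOver G S.1) where
  nonempty S := S.2.2.to_subtype
  connected := hG.ridgeGraph_connected
  adj_iff Q Q' := by
    constructor
    · rintro ⟨hne, h⟩
      exact ⟨hne, ⟨Q.1 ∩ Q'.1, h, ⟨Q, inter_subset_left⟩⟩, inter_subset_left, inter_subset_right⟩
    · rintro ⟨hne, S, hQ, hQ'⟩
      exact ⟨hne, by rw [hG.inter_eq hne S.2.1 hQ hQ', S.2.1]⟩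
  eq_of_mem S S' Q Q' hne hQ hQ' hR hR' := Subtype.ext <|
    (hG.inter_eq hne S.2.1 hQ hQ').symm.trans (hG.inter_eq hne S'.2.1 hR hR')
  card_eq := by
    have h := IsKTreeOn.sum_card_sub_one hG
    simp_rw [← hG.natCard_cliquesOver] at h
    have hX : Nat.card (MaxClique G) = #{Q | Q ⊆ univ ∧ G.IsNClique (k + 1) Q} := by
      rw [← Fintype.card_subtype, ← Nat.card_eq_fintype_card]
      refine Nat.card_congr (Equiv.subtypeEquivRight fun Q => ?_)
      simp [hG.maximal_isClique_iff]
    rw [hX, ← h, ← sum_subtype (univ.filter fun S => #S = k ∧ (cliquesOver G S).Nonempty)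
      (by simp) (fun S => Nat.card (cliquesOver G S) - 1)]
    congr 1
    refine sum_subset (fun S hS => by simpa using (mem_filter.1 hS).2.1) fun S hS hS' => ?_
    have : cliquesOver G S = ∅ := by
      rw [← Set.not_nonempty_iff_eq_empty]
      simp only [mem_filter, mem_univ, true_and, not_and] at hS'
      exact hS' (mem_powersetCard.1 hS).2
    simp [this]

lemma IsKTree.card_edgeInter_le (hG : IsKTree k G) {T : SimpleGraph (MaxClique G)}
    {e : Sym2 (MaxClique G)} (he : e ∈ T.edgeSet) : #(edgeInter G e) ≤ k := by
  induction e with | _ Q Q' =>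
  exact hG.card_inter_le (SimpleGraph.Adj.ne he)

/-- The clique trees of a `k`-tree are the spanning trees all of whose edges have weight `k`. -/
lemma IsKTree.isCliqueTree_iff (hk : 1 ≤ k) (hG : IsKTree k G) {T : SimpleGraph (MaxClique G)} :
    IsCliqueTree G T ↔ T ≤ ridgeGraph k G ∧ T.IsTree := by
  classical
  have hw : ∀ {U : SimpleGraph (MaxClique G)}, U ≤ ridgeGraph k G → U.IsTree →
      totalWeight G U = (Nat.card (MaxClique G) - 1) * k := fun {U} hU hUt => by
    rw [totalWeight, sum_congr rfl fun e he =>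
      le_ridgeGraph_iff.1 hU e (SimpleGraph.mem_edgeFinset.1 he), sum_const, smul_eq_mul,
      ← card_edgeFinset_add_one hUt, Nat.add_sub_cancel]
  have hle : ∀ {U : SimpleGraph (MaxClique G)} (e), e ∈ U.edgeFinset → #(edgeInter G e) ≤ k :=
    fun e he => hG.card_edgeInter_le (SimpleGraph.mem_edgeFinset.1 he)
  constructor
  · rintro ⟨⟨-, hT⟩, hmax⟩
    refine ⟨le_ridgeGraph_iff.2 fun e he => ?_, hT⟩
    -- Comparison with a spanning tree all of whose edges have weight `k`: since `k` bounds every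
    -- weight, maximality forces weight `k` on each edge of `T`.
    obtain ⟨U, hU, hUt⟩ := hG.ridgeGraph_connected.exists_isTree_le
    have h := hmax U ⟨hU.trans (ridgeGraph_le hk), hUt⟩
    rw [hw hU hUt, ← card_edgeFinset_add_one hT, Nat.add_sub_cancel, ← smul_eq_mul,
      ← sum_const] at h
    exact (sum_eq_sum_iff_of_le hle).1 ((sum_le_sum hle).antisymm h) e
      (SimpleGraph.mem_edgeFinset.2 he)
  · rintro ⟨hT, hTt⟩
    refine ⟨⟨hT.trans (ridgeGraph_le hk), hTt⟩, fun U hU => ?_⟩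
    rw [hw hT hTt, ← card_edgeFinset_add_one hU.2, Nat.add_sub_cancel, ← smul_eq_mul]
    exact sum_le_card_nsmul _ _ _ hle

/-- In a clique tree, the edges labelled `S` form a spanning tree on the cliques containing `S`. -/
lemma IsKTree.count_separatorMultiset (hG : IsKTree k G) {T : SimpleGraph (MaxClique G)}
    (hT : T ≤ ridgeGraph k G) (hTt : T.IsTree) (S : Finset V) :
    (separatorMultiset G T).count S = if #S = k then Nat.card (cliquesOver G S) - 1 else 0 := by
  classical
  have hcount : (separatorMultiset G T).count S = #{e ∈ T.edgeFinset | S = edgeInter G e} := by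
    rw [separatorMultiset, Multiset.count_map]
    rfl
  rw [hcount]
  by_cases hSk : #S = k
  swap
  · rw [if_neg hSk, card_eq_zero, filter_eq_empty_iff]
    rintro e he rfl
    exact hSk (le_ridgeGraph_iff.1 hT e (SimpleGraph.mem_edgeFinset.1 he))
  rw [if_pos hSk]
  by_cases hS : (cliquesOver G S).Nonempty
  · rw [← (SimpleGraph.isTree_iff_connected_and_card.1
      (hG.isBlockPartition.isTree_induce hT hTt ⟨S, hSk, hS⟩)).2, Nat.add_sub_cancel,
      ← Set.ncard_coe_finset, Nat.card_coe_set_eq (SimpleGraph.edgeSet _),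
      ← Set.ncard_image_of_injective (SimpleGraph.edgeSet _)
        (Sym2.map.injective Subtype.val_injective)]
    refine congrArg Set.ncard (Set.ext fun e => ?_)
    simp only [coe_filter, SimpleGraph.mem_edgeFinset, Set.mem_ofPred_eq, Set.mem_image]
    constructor
    · rintro ⟨he, rfl⟩
      induction e with | _ Q Q' =>
      exact ⟨s(⟨Q, inter_subset_left⟩, ⟨Q', inter_subset_right⟩), he, rfl⟩
    · rintro ⟨e, he, rfl⟩
      induction e with | _ Q Q' =>
      have he : T.Adj Q.1 Q'.1 := he
      exact ⟨he, (hG.inter_eq he.ne hSk Q.2 Q'.2).symm⟩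
  · rw [Set.not_nonempty_iff_eq_empty] at hS
    rw [hS, Nat.card_of_isEmpty, card_eq_zero, filter_eq_empty_iff]
    rintro e - rfl
    induction e with | _ Q Q' =>
    exact Set.eq_empty_iff_forall_notMem.1 hS Q (inter_subset_left)

/-- The separated pair consists of the vertices `u`, `v` completing `S` to the two cliques. Both are
adjacent to all of `S`, so omitting any `x ∈ S` opens the path `u, x, v`. -/
lemma IsKTree.isMinimalVertexSeparator (hG : IsKTree k G) {S : Finset V} (hSk : #S = k)
    {Q Q' : MaxClique G} (hne : Q ≠ Q') (hQ : S ⊆ Q.1) (hQ' : S ⊆ Q'.1) :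
    IsMinimalVertexSeparator G S := by
  have hins : ∀ R : MaxClique G, S ⊆ R.1 → ∃ u ∉ S, insert u S = R.1 := fun R hR => by
    have hc := (hG.isNClique R).card_eq
    exact (exists_eq_insert_iff.2 ⟨hR, by rw [hc, hSk]⟩)
  obtain ⟨u, huS, hu⟩ := hins Q hQ
  obtain ⟨v, hvS, hv⟩ := hins Q' hQ'
  have huv : u ≠ v := by
    rintro rfl
    exact hne (Subtype.ext (hu.symm.trans hv))
  obtain ⟨A, huA, hvA, hA⟩ := IsKTreeOn.exists_separation hG huS hvS huv
    (hu ▸ hG.isNClique Q) (hv ▸ hG.isNClique Q') (subset_univ _) (subset_univ _)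
  refine ⟨u, v, ⟨huv, fun h => hvA ((hA u huA).2.2 v (mem_univ v) hvS h), huS, hvS, ?_⟩, ?_⟩
  · rintro ⟨p⟩
    have : ∀ {x y : {x : V | x ∉ S}} (p : (G.induce {x : V | x ∉ S}).Walk x y),
        (x : V) ∈ A → (y : V) ∈ A := by
      intro x y p
      induction p with
      | nil => exact id
      | @cons x y z hadj _ ih => exact fun hx => ih ((hA _ hx).2.2 _ (mem_univ _) y.2 hadj)
    exact hvA (this p huA)
  · rintro S' hS' ⟨-, -, hu', hv', hsep⟩
    obtain ⟨x, hxS, hxS'⟩ := exists_of_ssubset hS'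
    have hadj : ∀ {w : V} {R : MaxClique G}, w ∉ S → insert w S = R.1 → G.Adj w x :=
      fun {w R} hw hR => (hG.isNClique R).isClique (hR ▸ mem_insert_self _ _)
        (hR ▸ mem_insert_of_mem hxS) (by rintro rfl; exact hw hxS)
    refine hsep ((SimpleGraph.Adj.reachable (v := ⟨x, hxS'⟩) ?_).trans
      (SimpleGraph.Adj.reachable ?_))
    · exact hadj huS hu
    · exact (hadj hvS hv).symm

lemma IsKTree.exists_isCliqueTree (hk : 1 ≤ k) (hG : IsKTree k G) :
    ∃ T : SimpleGraph (MaxClique G), IsCliqueTree G T := by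
  obtain ⟨T, hT⟩ := hG.ridgeGraph_connected.exists_isTree_le
  exact ⟨T, (hG.isCliqueTree_iff hk).2 hT⟩

lemma IsKTree.multiplicity_eq (hk : 1 ≤ k) (hG : IsKTree k G) (S : Finset V) :
    multiplicity G S = if #S = k then Nat.card (cliquesOver G S) - 1 else 0 := by
  have hex := hG.exists_isCliqueTree hk
  have hT := (hG.isCliqueTree_iff hk).1 hex.choose_spec
  rw [multiplicity, dif_pos hex, hG.count_separatorMultiset hT.1 hT.2]

lemma IsKTree.ncard_isCliqueTree (hk : 1 ≤ k) (hG : IsKTree k G) :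
    {T : SimpleGraph (MaxClique G) | IsCliqueTree G T}.ncard =
      ∏ S ∈ minimalVertexSeparators G, (multiplicity G S + 1) ^ (multiplicity G S - 1) := by
  classical
  have hmul := hG.multiplicity_eq hk
  have hnum : {T : SimpleGraph (MaxClique G) | IsCliqueTree G T}.ncard =
      ∏ S : Ridge k G, (multiplicity G S.1 + 1) ^ (multiplicity G S.1 - 1) := by
    rw [← Nat.card_coe_set_eq, Set.coe_ofPred]
    simp_rw [hG.isCliqueTree_iff hk]
    rw [hG.isBlockPartition.natCard_spanningTrees]
    refine prod_congr rfl fun S _ => ?_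
    have := S.2.2.to_subtype
    have hpos : 0 < Nat.card (cliquesOver G S.1) := Nat.card_pos
    rw [numTrees_eq hpos, hmul, if_pos S.2.1, Nat.sub_add_cancel hpos, Nat.sub_sub]
  rw [hnum, ← prod_subtype
    (univ.filter fun S => #S = k ∧ (cliquesOver G S).Nonempty) (by simp)
    (fun S => (multiplicity G S + 1) ^ (multiplicity G S - 1))]
  -- The two index sets need only agree where the multiplicity is nonzero: elsewhere the factor is
  -- `1 ^ 0`, the exponent `0 - 1` being truncated. Thus no proof is needed that every minimal
  -- separator has `k` vertices.
  have hone : ∀ S, multiplicity G S = 0 →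
      (multiplicity G S + 1) ^ (multiplicity G S - 1) = 1 := fun S h => by rw [h]; rfl
  have hpos : ∀ S, multiplicity G S ≠ 0 → #S = k ∧ 2 ≤ Nat.card (cliquesOver G S) := fun S h => by
    rw [hmul] at h
    split_ifs at h with hS
    · exact ⟨hS, by omega⟩
    · exact absurd rfl h
  rw [← prod_filter_of_ne (p := fun S => multiplicity G S ≠ 0)
      (fun S _ h h0 => h (hone S h0)),
    ← prod_filter_of_ne (s := minimalVertexSeparators G)
      (p := fun S => multiplicity G S ≠ 0) (fun S _ h h0 => h (hone S h0))]
  refine prod_congr (ext fun S => ?_) fun _ _ => rfl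
  simp only [mem_filter, mem_univ, true_and, minimalVertexSeparators]
  refine and_congr_left fun h => ?_
  obtain ⟨hSk, h2⟩ := hpos S h
  rw [Nat.card_coe_set_eq] at h2
  obtain ⟨Q, hQ, Q', hQ', hne⟩ := (Set.one_lt_ncard (Set.toFinite _)).1 h2
  exact iff_of_true ⟨hSk, Q, hQ⟩ (hG.isMinimalVertexSeparator hSk hne hQ hQ')

end CliqueTrees

end KTreeClique

theorem mainTheorem3 {V : Type*} [Fintype V] [DecidableEq V] (k : ℕ) (hk : 1 ≤ k)
    (G : SimpleGraph V) (hG : KTreeClique.IsKTree k G) :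
    (∃ T : SimpleGraph (KTreeClique.MaxClique G), KTreeClique.IsCliqueTree G T) ∧
    (∀ T : SimpleGraph (KTreeClique.MaxClique G), KTreeClique.IsCliqueTree G T →
      ∀ S : Finset V,
        (KTreeClique.separatorMultiset G T).count S = KTreeClique.multiplicity G S) ∧
    {T : SimpleGraph (KTreeClique.MaxClique G) | KTreeClique.IsCliqueTree G T}.ncard =
      ∏ S ∈ KTreeClique.minimalVertexSeparators G,
        (KTreeClique.multiplicity G S + 1) ^ (KTreeClique.multiplicity G S - 1) := by
  refine ⟨hG.exists_isCliqueTree hk, fun T hT S => ?_, hG.ncard_isCliqueTree hk⟩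
  have hT := (hG.isCliqueTree_iff hk).1 hT
  rw [hG.count_separatorMultiset hT.1 hT.2, hG.multiplicity_eq hk]
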